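/- Let $n\ge 1$ and let $\sigma=(\sigma_{ij})$ be a non-degenerate complex symmetric $n\times n$ matrix. On $\mathbb{C}^{4n}=\mathbb{R}^{8n}$ consider the real function $$f(z)=\sum_{a=1}^{2n}\bigl(z^a\,\overline{z^{a+2n}}+z^{a+2n}\,\overline{z^{a}}\bigr)+\Bigl|\sum_{i,j=1}^n\sigma_{ij}z^iz^{j+n}\Bigr|^2$$ and the pseudo-Kähler metric $g=\sum_{A,B=1}^{4n} h_{AB}\,dz^A\cdot d\overline{z}^B$ with $h_{AB}=\dfrac{\partial^2 f}{\partial z^A\,\partial\overline{z}^B}$, so that $g_z(u,v)=\operatorname{Re}\sum_{A,B}h_{AB}(z)u^A\overline{v^B}$ for $z,u,v\in\mathbb{C}^{4n}$. For $p\in\mathbb{C}^{4n}$, a symmetry at $p$ is a smooth isometry $s_p$ of $(\mathbb{C}^{4n},g)$ with $s_p(p)=p$ and $(ds_p)_p=-\mathrm{id}$. Let $G$ be the group of transvections of $(\mathbb{C}^{4n},g)$, that is, the group of diffeomorphisms generated by all products $s_p\circ s_q$ with $p,q\in\mathbb{C}^{4n}$. Then $G$ is $3$-step nilpotent, that is,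 nilpotent of class exactly $3$. Moreover, for every point $p\in\mathbb{C}^{4n}$, the isotropy group $G_p=\{\varphi\in G:\varphi(p)=p\}$ is abelian and unipotent: $d\varphi_p-\mathrm{id}$ is nilpotent for every $\varphi\in G_p$. The isotropy algebra at $p$, that is, the Lie algebra $\{A\in\operatorname{End}_{\mathbb{R}}(T_p\mathbb{C}^{4n}) : \exp(tA)\in\{d\varphi_p:\varphi\in G_p\}\text{ for all }t\in\mathbb{R}\}$ of $G_p$ in its isotropy representation, is an abelian Lie subalgebra of $\operatorname{End}_{\mathbb{R}}(T_p\mathbb{C}^{4n})$ that consists of nilpotent endomorphisms and has real dimension $4n^2$. -/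

import Mathlib

open Complex
open scoped ContDiff ComplexConjugate

/- The commutator bracket of linear endomorphisms. -/
attribute [local instance 100] LieRing.ofAssociativeRing

noncomputable section

namespace KahlerTransvection

/-- The index set `{1, …, 2n}`: `Sum.inl i` is the index `i`, `Sum.inr i` is the index `i + n`. -/
abbrev HalfIdx (n : ℕ) : Type := Fin n ⊕ Fin n

/-- The index set `{1, …, 4n}`: `Sum.inl a` is the index `a ≤ 2n`, `Sum.inr a` is the index
`a + 2n`. -/
abbrev Idx (n : ℕ) : Type := HalfIdx n ⊕ HalfIdx n

/-- The manifold `ℂ^{4n} = ℝ^{8n}`. -/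
abbrev Space (n : ℕ) : Type := Idx n → ℂ

/-- The quadratic polynomial `σ_{ij} z^i z^{j+n}`. -/
def sigmaPoly {n : ℕ} (σ : Matrix (Fin n) (Fin n) ℂ) (z : Space n) : ℂ :=
  ∑ i, ∑ j, σ i j * z (Sum.inl (Sum.inl i)) * z (Sum.inl (Sum.inr j))

/-- The real Kähler potential
`∑_{a ≤ 2n} (z^a conj(z^{a+2n}) + z^{a+2n} conj(z^a)) + σ(z) conj(σ(z))`. -/
def potential {n : ℕ} (σ : Matrix (Fin n) (Fin n) ℂ) (z : Space n) : ℝ :=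
  2 * (∑ a : HalfIdx n, z (Sum.inl a) * conj (z (Sum.inr a))).re + normSq (sigmaPoly σ z)

/-- The Wirtinger derivative `∂/∂z^A = (∂/∂x^A - i ∂/∂y^A) / 2`, where `z^A = x^A + i y^A`. -/
def dz {n : ℕ} (A : Idx n) (F : Space n → ℂ) (z : Space n) : ℂ :=
  (fderiv ℝ F z (Pi.single A 1) - I * fderiv ℝ F z (Pi.single A I)) / 2

/-- The Wirtinger derivative `∂/∂(conj z^A) = (∂/∂x^A + i ∂/∂y^A) / 2`. -/
def dzbar {n : ℕ} (A : Idx n) (F : Space n → ℂ) (z : Space n) : ℂ :=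
  (fderiv ℝ F z (Pi.single A 1) + I * fderiv ℝ F z (Pi.single A I)) / 2

/-- The coefficients `h_{AB} = ∂²f / ∂z^A ∂(conj z^B)` of the Kähler metric with potential `f`. -/
def hCoeff {n : ℕ} (σ : Matrix (Fin n) (Fin n) ℂ) (A B : Idx n) (z : Space n) : ℂ :=
  dz A (dzbar B (fun w => (potential σ w : ℂ))) z

/-- The Kähler metric `g = h_{AB} dz^A · d(conj z^B)`, evaluated at the point `z` on the real
tangent vectors `u`, `v` of `ℂ^{4n}`. -/
def metric {n : ℕ} (σ : Matrix (Fin n) (Fin n) ℂ) (z u v : Space n) : ℝ :=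
  (∑ A, ∑ B, hCoeff σ A B z * u A * conj (v B)).re

/-- `φ` is an isometry of `(ℂ^{4n}, g)`: a smooth diffeomorphism with `φ^* g = g`. -/
def IsIsometry {n : ℕ} (σ : Matrix (Fin n) (Fin n) ℂ) (φ : Equiv.Perm (Space n)) : Prop :=
  ContDiff ℝ ∞ φ ∧ ContDiff ℝ ∞ φ.symm ∧
    ∀ z u v : Space n, metric σ (φ z) (fderiv ℝ φ z u) (fderiv ℝ φ z v) = metric σ z u v

/-- `s` is the symmetry of `(ℂ^{4n}, g)` at the point `p`: an isometry which fixes `p` and has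
differential `-id` there. -/
def IsSymmetryAt {n : ℕ} (σ : Matrix (Fin n) (Fin n) ℂ) (p : Space n)
    (s : Equiv.Perm (Space n)) : Prop :=
  IsIsometry σ s ∧ s p = p ∧ fderiv ℝ s p = -ContinuousLinearMap.id ℝ (Space n)

/-- The group of transvections of `(ℂ^{4n}, g)`: the group generated by the products `s_p ∘ s_q`
of two symmetries. -/
def transvectionGroup {n : ℕ} (σ : Matrix (Fin n) (Fin n) ℂ) : Subgroup (Equiv.Perm (Space n)) :=
  Subgroup.closure {φ | ∃ p q : Space n, ∃ s t : Equiv.Perm (Space n),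
    IsSymmetryAt σ p s ∧ IsSymmetryAt σ q t ∧ φ = s * t}

/-- The isotropy group at `p`: the stabilizer of `p` in the group of transvections. -/
def isotropyGroup {n : ℕ} (σ : Matrix (Fin n) (Fin n) ℂ) (p : Space n) :
    Subgroup (Equiv.Perm (Space n)) :=
  transvectionGroup σ ⊓ MulAction.stabilizer (Equiv.Perm (Space n)) p

/-- The isotropy algebra at `p`: the Lie algebra of the isotropy group at `p`, where the latter is
regarded through its isotropy representation `φ ↦ dφ_p` as a group of linear automorphisms of the
tangent space at `p`. It consists of the generators of the one-parameter groups `t ↦ exp (t A)` in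
that linear group. -/
def isotropyAlgebra {n : ℕ} (σ : Matrix (Fin n) (Fin n) ℂ) (p : Space n) :
    Set (Space n →L[ℝ] Space n) :=
  {A | ∀ t : ℝ, ∃ φ ∈ isotropyGroup σ p, fderiv ℝ φ p = NormedSpace.exp (t • A)}

end KahlerTransvection

end

noncomputable section

namespace KahlerTransvection

/-! Write `z = (x, y)` with `x, y ∈ ℂ^{2n}`, let `B` be the symmetric bilinear form with `σ(z) =
B(x, x)`, and let `η(x)` be the covector `B(x, ·)`. The metric is the real part of `⟨u_x, v_y⟩ +
⟨u_y, v_x⟩ + 4 B(x, u_x) conj B(x, v_x)` (`metric_eq`). Its geodesic equation is triangular: `x'' =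
0` and `y'' = -4 B(x', x') conj η(x)`. Geodesics are therefore cubic polynomials, and they join any
two points. Isometries preserve them, so an isometry is determined by its value and differential at
one point (`IsIsometry.eq_of_fderiv_eq`); hence the explicit map `geodesicSymm σ p` is the only
symmetry at `p`.

A product of two symmetries is a `transv σ h M k`: it translates `x` by `h` and adds to `y` a
quadratic term fixed by `h`, a linear term `M x` with `M` skew-Hermitian, and a constant. Under
composition the `h` add, while the `M` add up to a cocycle in the `h` (`transv_mul`). Non-degeneracy
of `σ` makes `η` surjective, so sums of cocycle values exhaust the skew-Hermitian matrices and `G`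
consists of all these maps (`transvectionGroup_eq`).

Commutators descend from `h` to `M` to `k` and then to the identity, which bounds the class by 3; a
triple commutator that is not trivial shows equality. Fixing a point forces `h = 0` and determines
`k` from `M`. The isotropy algebra thus consists of the maps `(u_x, u_y) ↦ (0, M u_x)`, whose
pairwise products vanish, and its dimension is that of the skew-Hermitian `2n × 2n` matrices, namely
`(2n)²`. -/

/-- The space `ℂ^{2n}` of which `ℂ^{4n}` is the double. -/
abbrev Half (n : ℕ) : Type := HalfIdx n → ℂ

/-! ### The two halves of the coordinates and the polarized quadratic form. -/

variable {n : ℕ}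

/-- The first `2n` coordinates. -/
def fstPart : Space n →L[ℝ] Half n :=
  ContinuousLinearMap.pi fun a => ContinuousLinearMap.proj (Sum.inl a)

/-- The last `2n` coordinates. -/
def sndPart : Space n →L[ℝ] Half n :=
  ContinuousLinearMap.pi fun a => ContinuousLinearMap.proj (Sum.inr a)

/-- The point of `ℂ^{4n}` with the given halves. -/
def joinCLM : Half n × Half n →L[ℝ] Space n :=
  ContinuousLinearMap.pi fun A => Sum.rec
    (fun a => (ContinuousLinearMap.proj a).comp (ContinuousLinearMap.fst ℝ (Half n) (Half n)))
    (fun a => (ContinuousLinearMap.proj a).comp (ContinuousLinearMap.snd ℝ (Half n) (Half n))) A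

/-- The point of `ℂ^{4n}` with the given halves. -/
def join (x y : Half n) : Space n := joinCLM (x, y)

@[simp] lemma fstPart_apply (z : Space n) (a : HalfIdx n) : fstPart z a = z (Sum.inl a) := rfl
@[simp] lemma sndPart_apply (z : Space n) (a : HalfIdx n) : sndPart z a = z (Sum.inr a) := rfl
@[simp] lemma join_inl (x y : Half n) (a : HalfIdx n) : join x y (Sum.inl a) = x a := rfl
@[simp] lemma join_inr (x y : Half n) (a : HalfIdx n) : join x y (Sum.inr a) = y a := rfl
@[simp] lemma joinCLM_apply (w : Half n × Half n) : joinCLM w = join w.1 w.2 := rfl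
@[simp] lemma fstPart_join (x y : Half n) : fstPart (join x y) = x := rfl
@[simp] lemma sndPart_join (x y : Half n) : sndPart (join x y) = y := rfl

lemma ext_parts {z w : Space n} (h₁ : fstPart z = fstPart w) (h₂ : sndPart z = sndPart w) :
    z = w := by
  funext A
  rcases A with a | a
  · exact congrFun h₁ a
  · exact congrFun h₂ a

/-- The symmetric matrix of the quadratic form `σ_{ij} z^i z^{j+n}`. -/
def polarMatrix (σ : Matrix (Fin n) (Fin n) ℂ) : Matrix (HalfIdx n) (HalfIdx n) ℂ :=
  (1 / 2 : ℂ) • Matrix.fromBlocks 0 σ σ.transpose 0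

lemma polarMatrix_transpose (σ : Matrix (Fin n) (Fin n) ℂ) :
    (polarMatrix σ).transpose = polarMatrix σ := by
  simp [polarMatrix, Matrix.fromBlocks_transpose]

/-- The covector of a point with respect to the symmetric bilinear form, as a linear map. -/
def covector (σ : Matrix (Fin n) (Fin n) ℂ) : Half n →L[ℂ] Half n :=
  LinearMap.toContinuousLinearMap (Matrix.mulVecLin (polarMatrix σ))

lemma covector_apply (σ : Matrix (Fin n) (Fin n) ℂ) (x : Half n) :
    covector σ x = Matrix.mulVec (polarMatrix σ) x := rfl

/-- The polarization of the quadratic form `σ_{ij} z^i z^{j+n}`. -/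
def form (σ : Matrix (Fin n) (Fin n) ℂ) : Half n →L[ℝ] Half n →L[ℝ] ℂ :=
  LinearMap.toContinuousBilinearMap
    (LinearMap.mk₂ ℝ (fun x u => covector σ x ⬝ᵥ u)
      (fun x y u => by simp) (fun c x u => (congrArg (· ⬝ᵥ u)
        (map_smul ((covector σ).restrictScalars ℝ) c x)).trans (smul_dotProduct c _ u)) (fun x u v => by simp) (fun c x u => by simp))

/-- The Hermitian pairing on `ℂ^{2n}`. -/
def pairing : Half n →L[ℝ] Half n →L[ℝ] ℂ :=
  LinearMap.toContinuousBilinearMap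
    (LinearMap.mk₂ ℝ (fun x u => x ⬝ᵥ star u)
      (fun x y u => by simp) (fun c x u => by simp) (fun x u v => by simp)
      (fun c x u => by simp))

lemma form_apply (σ : Matrix (Fin n) (Fin n) ℂ) (x u : Half n) :
    form σ x u = covector σ x ⬝ᵥ u := rfl

lemma pairing_apply (x u : Half n) : pairing x u = x ⬝ᵥ star u := rfl

lemma form_comm (σ : Matrix (Fin n) (Fin n) ℂ) (x u : Half n) : form σ x u = form σ u x := by
  rw [form_apply, form_apply, covector_apply, covector_apply, dotProduct_comm,
    Matrix.dotProduct_mulVec, ← Matrix.mulVec_transpose, polarMatrix_transpose]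

lemma form_smul_left (σ : Matrix (Fin n) (Fin n) ℂ) (c : ℂ) (x u : Half n) :
    form σ (c • x) u = c * form σ x u := by simp [form_apply]

lemma form_smul_right (σ : Matrix (Fin n) (Fin n) ℂ) (c : ℂ) (x u : Half n) :
    form σ x (c • u) = c * form σ x u := by simp [form_apply]

lemma sigmaPoly_eq (σ : Matrix (Fin n) (Fin n) ℂ) (z : Space n) :
    sigmaPoly σ z = form σ (fstPart z) (fstPart z) := by
  simp only [form_apply, covector_apply, sigmaPoly, polarMatrix, dotProduct, Matrix.mulVec,
    Fintype.sum_sum_type, Matrix.smul_apply, Matrix.fromBlocks_apply₁₁, Matrix.fromBlocks_apply₁₂,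
    Matrix.fromBlocks_apply₂₁, Matrix.fromBlocks_apply₂₂, Matrix.zero_apply, fstPart_apply,
    smul_eq_mul, mul_zero, zero_mul, Finset.sum_const_zero, zero_add, add_zero,
    Matrix.transpose_apply, Finset.sum_mul]
  rw [Finset.sum_comm (γ := Fin n) (s := Finset.univ) (t := Finset.univ)
    (f := fun i j => (1 / 2 : ℂ) * σ j i * z (Sum.inl (Sum.inl j)) * z (Sum.inl (Sum.inr i))),
    ← Finset.sum_add_distrib]
  refine Finset.sum_congr rfl fun i _ => ?_
  rw [← Finset.sum_add_distrib]
  exact Finset.sum_congr rfl fun j _ => by ring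

/-! ### The metric in closed form. -/

lemma potential_eq (σ : Matrix (Fin n) (Fin n) ℂ) (z : Space n) :
    (potential σ z : ℂ) = pairing (fstPart z) (sndPart z) + conj (pairing (fstPart z) (sndPart z))
      + form σ (fstPart z) (fstPart z) * conj (form σ (fstPart z) (fstPart z)) := by
  rw [Complex.add_conj, Complex.mul_conj, ← sigmaPoly_eq]
  simp [potential, pairing_apply, dotProduct]

lemma hasFDerivAt_form_self (σ : Matrix (Fin n) (Fin n) ℂ) (z : Space n) :
    HasFDerivAt (fun z : Space n => form σ (fstPart z) (fstPart z))
      ((2 : ℝ) • (form σ (fstPart z)).comp fstPart) z := by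
  have h := (form σ).hasFDerivAt_of_bilinear (fstPart (n := n)).hasFDerivAt
    (fstPart (n := n)).hasFDerivAt (x := z)
  refine h.congr_fderiv ?_
  ext u
  simp [form_comm σ (fstPart u), two_mul]

lemma exists_hasFDerivAt_potential (σ : Matrix (Fin n) (Fin n) ℂ) (z : Space n) :
    ∃ F' : Space n →L[ℝ] ℂ, HasFDerivAt (fun w => (potential σ w : ℂ)) F' z ∧
      ∀ u, F' u = 2 * (((pairing (fstPart u) (sndPart z) + conj (pairing (fstPart z) (sndPart u))
        + 2 * form σ (fstPart z) (fstPart u) * conj (form σ (fstPart z) (fstPart z))).re : ℝ) : ℂ)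
          := by
  have h₁ := (pairing (n := n)).hasFDerivAt_of_bilinear (fstPart (n := n)).hasFDerivAt
    (sndPart (n := n)).hasFDerivAt (x := z)
  have h₂ := hasFDerivAt_form_self σ z
  have h₁' := (conjCLE : ℂ →L[ℝ] ℂ).hasFDerivAt.comp z h₁
  have h₂' := (conjCLE : ℂ →L[ℝ] ℂ).hasFDerivAt.comp z h₂
  refine ⟨_, ((h₁.add h₁').add (h₂.mul h₂')).congr_of_eventuallyEq
    (Filter.Eventually.of_forall fun w => ?_), fun u => ?_⟩
  · simpa using potential_eq σ w
  · apply Complex.ext <;> simp <;> ring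

lemma fstPart_single_inl (a : HalfIdx n) (c : ℂ) :
    fstPart (Pi.single (Sum.inl a) c : Space n) = Pi.single a c := by
  ext b; simp [Pi.single_apply]

lemma fstPart_single_inr (a : HalfIdx n) (c : ℂ) :
    fstPart (Pi.single (Sum.inr a) c : Space n) = 0 := by
  ext b; simp

lemma sndPart_single_inr (a : HalfIdx n) (c : ℂ) :
    sndPart (Pi.single (Sum.inr a) c : Space n) = Pi.single a c := by
  ext b; simp [Pi.single_apply]

lemma sndPart_single_inl (a : HalfIdx n) (c : ℂ) :
    sndPart (Pi.single (Sum.inl a) c : Space n) = 0 := by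
  ext b; simp

lemma dzbar_potential_inl (σ : Matrix (Fin n) (Fin n) ℂ) (b : HalfIdx n) (z : Space n) :
    dzbar (Sum.inl b) (fun w => (potential σ w : ℂ)) z = z (Sum.inr b) +
      2 * form σ (fstPart z) (fstPart z) * conj (covector σ (fstPart z) b) := by
  obtain ⟨F', hF, hu⟩ := exists_hasFDerivAt_potential σ z
  rw [dzbar, hF.fderiv, hu, hu]
  apply Complex.ext <;>
  simp [fstPart_single_inl, sndPart_single_inl, pairing_apply, form_apply] <;> ring

lemma dzbar_potential_inr (σ : Matrix (Fin n) (Fin n) ℂ) (b : HalfIdx n) (z : Space n) :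
    dzbar (Sum.inr b) (fun w => (potential σ w : ℂ)) z = z (Sum.inl b) := by
  obtain ⟨F', hF, hu⟩ := exists_hasFDerivAt_potential σ z
  rw [dzbar, hF.fderiv, hu, hu]
  apply Complex.ext <;>
  simp [fstPart_single_inr, sndPart_single_inr, pairing_apply, form_apply,
    Pi.single_apply, apply_ite conj, dotProduct]

lemma dz_coord (A B : Idx n) (z : Space n) :
    dz A (fun w => w B) z = if A = B then 1 else 0 := by
  have h : HasFDerivAt (fun w : Space n => w B)
    (ContinuousLinearMap.proj (R := ℝ) (φ := fun _ : Idx n => ℂ) B) z :=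
    (ContinuousLinearMap.proj (R := ℝ) (φ := fun _ : Idx n => ℂ) B).hasFDerivAt
  rw [dz, h.fderiv]
  by_cases hAB : A = B
  · subst hAB; simp
  · simp [hAB, Ne.symm hAB]

lemma hCoeff_inr (σ : Matrix (Fin n) (Fin n) ℂ) (A : Idx n) (b : HalfIdx n) (z : Space n) :
    hCoeff σ A (Sum.inr b) z = if A = Sum.inl b then 1 else 0 := by
  rw [hCoeff, funext (dzbar_potential_inr σ b), dz_coord]

/-- The quadratic form is holomorphic and the conjugated covector antiholomorphic, so in the product
rule `∂/∂z^A` sees only the former. The factor 4 is 2 from each of the two derivatives. -/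
lemma hCoeff_inl (σ : Matrix (Fin n) (Fin n) ℂ) (A : Idx n) (b : HalfIdx n) (z : Space n) :
    hCoeff σ A (Sum.inl b) z = (if A = Sum.inr b then 1 else 0) +
      4 * form σ (fstPart z) (fstPart (Pi.single A 1)) * conj (covector σ (fstPart z) b) := by
  rw [hCoeff, funext (dzbar_potential_inl σ b)]
  have h₁ : HasFDerivAt (fun w : Space n => w (Sum.inr b))
    (ContinuousLinearMap.proj (R := ℝ) (φ := fun _ : Idx n => ℂ) (Sum.inr b)) z :=
    (ContinuousLinearMap.proj (R := ℝ) (φ := fun _ : Idx n => ℂ) (Sum.inr b)).hasFDerivAt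
  let C : Space n →L[ℝ] ℂ := (ContinuousLinearMap.proj (R := ℝ) (φ := fun _ : HalfIdx n => ℂ) b).comp
    (((covector σ).restrictScalars ℝ).comp fstPart)
  have hC : HasFDerivAt (fun w : Space n => conj (covector σ (fstPart w) b))
    ((conjCLE : ℂ →L[ℝ] ℂ).comp C) z := ((conjCLE : ℂ →L[ℝ] ℂ).comp C).hasFDerivAt
  have h₂ := ((hasFDerivAt_form_self σ z).const_mul 2).fun_mul hC
  have hs : (Pi.single A I : Space n) = I • Pi.single A 1 := by
    rw [← Pi.single_smul]; simp
  have hf : fstPart (I • Pi.single A 1 : Space n) = I • fstPart (Pi.single A 1 : Space n) := by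
    ext; simp
  rw [← dz_coord A (Sum.inr b) z, dz, dz, (h₁.fun_add h₂).fderiv, h₁.fderiv, hs]
  simp only [C, add_apply, smul_apply,
    ContinuousLinearMap.comp_apply, hf, form_smul_right, ContinuousLinearMap.proj_apply,
    ContinuousLinearMap.coe_restrictScalars', map_smul, Pi.smul_apply, smul_eq_mul]
  simp
  linear_combination (-2 * form σ (fstPart z) (fstPart (Pi.single A 1)) *
    conj (covector σ (fstPart z) b) + form σ (fstPart z) (fstPart z) * conj (covector σ (fstPart (Pi.single A 1)) b)) * Complex.I_sq

lemma sum_form_single (σ : Matrix (Fin n) (Fin n) ℂ) (x : Half n) (u : Space n) :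
    ∑ A, form σ x (fstPart (Pi.single A 1)) * u A = form σ x (fstPart u) := by
  rw [Fintype.sum_sum_type]
  simp only [fstPart_single_inl, fstPart_single_inr, form_apply, dotProduct_single, map_zero,
    zero_mul, Finset.sum_const_zero, add_zero, mul_one]
  rfl

lemma metric_eq (σ : Matrix (Fin n) (Fin n) ℂ) (z u v : Space n) :
    metric σ z u v = (pairing (fstPart u) (sndPart v) + pairing (sndPart u) (fstPart v) +
      4 * form σ (fstPart z) (fstPart u) * conj (form σ (fstPart z) (fstPart v))).re := by
  have h₁ : ∑ A, ∑ b, hCoeff σ A (Sum.inl b) z * u A * conj (v (Sum.inl b)) =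
      pairing (sndPart u) (fstPart v) +
        4 * form σ (fstPart z) (fstPart u) * conj (form σ (fstPart z) (fstPart v)) := by
    have h : ∀ A b, hCoeff σ A (Sum.inl b) z * u A * conj (v (Sum.inl b)) =
        (if A = Sum.inr b then u A * conj (v (Sum.inl b)) else 0) +
          4 * (form σ (fstPart z) (fstPart (Pi.single A 1)) * u A) *
            conj (covector σ (fstPart z) b * v (Sum.inl b)) := fun A b => by
      rw [hCoeff_inl, map_mul]
      split_ifs <;> ring
    simp_rw [h, Finset.sum_add_distrib, ← Finset.mul_sum, ← map_sum, ← Finset.sum_mul,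
      ← Finset.mul_sum, sum_form_single]
    rw [Finset.sum_comm]
    simp [pairing_apply, form_apply, dotProduct]
  have h₂ : ∑ A, ∑ b, hCoeff σ A (Sum.inr b) z * u A * conj (v (Sum.inr b)) =
      pairing (fstPart u) (sndPart v) := by
    simp_rw [hCoeff_inr]
    rw [Finset.sum_comm]
    simp [pairing_apply, dotProduct]
  rw [metric]
  congr 1
  simp_rw [Fintype.sum_sum_type (α₁ := HalfIdx n) (α₂ := HalfIdx n) (f := fun B =>
    hCoeff σ _ B z * u _ * conj (v B)), Finset.sum_add_distrib, h₁, h₂]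
  ring

/-! ### Isometries and their second derivatives. -/

lemma hasDerivAt_metric (σ : Matrix (Fin n) (Fin n) ℂ) {c U V : ℝ → Space n}
    {c' U' V' : Space n} {t : ℝ} (hc : HasDerivAt c c' t) (hU : HasDerivAt U U' t)
    (hV : HasDerivAt V V' t) :
    HasDerivAt (fun s => metric σ (c s) (U s) (V s))
      (metric σ (c t) U' (V t) + metric σ (c t) (U t) V' +
        4 * (form σ (fstPart c') (fstPart (U t)) * conj (form σ (fstPart (c t)) (fstPart (V t))) +
          form σ (fstPart (c t)) (fstPart (U t)) *
            conj (form σ (fstPart c') (fstPart (V t)))).re) t := by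
  have hX {f : ℝ → Space n} {f' : Space n} (hf : HasDerivAt f f' t) :
      HasDerivAt (fun s => fstPart (f s)) (fstPart f') t :=
    (fstPart (n := n)).hasFDerivAt.comp_hasDerivAt t hf
  have hY {f : ℝ → Space n} {f' : Space n} (hf : HasDerivAt f f' t) :
      HasDerivAt (fun s => sndPart (f s)) (sndPart f') t :=
    (sndPart (n := n)).hasFDerivAt.comp_hasDerivAt t hf
  have hB {f g : ℝ → Half n} {f' g' : Half n} (T : Half n →L[ℝ] Half n →L[ℝ] ℂ)
      (hf : HasDerivAt f f' t) (hg : HasDerivAt g g' t) :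
      HasDerivAt (fun s => T (f s) (g s)) (T f' (g t) + T (f t) g') t :=
    (T.hasFDerivAt.comp_hasDerivAt t hf).clm_apply hg
  have hconj {f : ℝ → ℂ} {f' : ℂ} (hf : HasDerivAt f f' t) :
      HasDerivAt (fun s => conj (f s)) (conj f') t :=
    (conjCLE : ℂ →L[ℝ] ℂ).hasFDerivAt.comp_hasDerivAt t hf
  have key := ((hB pairing (hX hU) (hY hV)).fun_add (hB pairing (hY hU) (hX hV))).fun_add
    (((hB (form σ) (hX hc) (hX hU)).const_mul 4).fun_mul
      (hconj (hB (form σ) (hX hc) (hX hV))))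
  have hre := (Complex.reCLM).hasFDerivAt.comp_hasDerivAt t key
  simp_rw [metric_eq]
  refine hre.congr_deriv ?_
  simp
  ring

lemma metric_comm (σ : Matrix (Fin n) (Fin n) ℂ) (z u v : Space n) :
    metric σ z u v = metric σ z v u := by
  have h : ∀ x y : Half n, pairing x y = conj (pairing y x) := fun x y => by
    simp [pairing_apply, dotProduct, mul_comm]
  rw [metric_eq, metric_eq, h (fstPart u), h (sndPart u)]
  simp
  ring

lemma IsIsometry.differentiable {σ : Matrix (Fin n) (Fin n) ℂ} {φ : Equiv.Perm (Space n)}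
    (hφ : IsIsometry σ φ) : Differentiable ℝ φ := hφ.1.differentiable (by simp)

lemma IsIsometry.differentiable_fderiv {σ : Matrix (Fin n) (Fin n) ℂ} {φ : Equiv.Perm (Space n)}
    (hφ : IsIsometry σ φ) : Differentiable ℝ (fderiv ℝ φ) :=
  (hφ.1.fderiv_right (m := 1) (by norm_cast)).differentiable (by simp)

lemma IsIsometry.fderiv_surjective {σ : Matrix (Fin n) (Fin n) ℂ} {φ : Equiv.Perm (Space n)}
    (hφ : IsIsometry σ φ) (z : Space n) : Function.Surjective (fderiv ℝ φ z) := by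
  have h₁ : HasFDerivAt φ.symm (fderiv ℝ φ.symm (φ z)) (φ z) :=
    (hφ.2.1.differentiable (by simp) _).hasFDerivAt
  have h₂ : HasFDerivAt φ (fderiv ℝ φ z) (φ.symm (φ z)) := by
    rw [φ.symm_apply_apply]; exact (hφ.differentiable z).hasFDerivAt
  have h₃ := h₂.comp _ h₁
  rw [φ.self_comp_symm] at h₃
  have h₄ := h₃.unique (hasFDerivAt_id _)
  exact fun w => ⟨fderiv ℝ φ.symm (φ z) w, by simpa using congrArg (fun T => T w) h₄⟩

/-- The derivative of the isometry equation in the direction `w`. -/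
lemma IsIsometry.metric_deriv {σ : Matrix (Fin n) (Fin n) ℂ} {φ : Equiv.Perm (Space n)}
    (hφ : IsIsometry σ φ) (z w u v : Space n) :
    metric σ (φ z) (fderiv ℝ (fderiv ℝ φ) z w u) (fderiv ℝ φ z v) +
      metric σ (φ z) (fderiv ℝ φ z u) (fderiv ℝ (fderiv ℝ φ) z w v) +
      4 * (form σ (fstPart (fderiv ℝ φ z w)) (fstPart (fderiv ℝ φ z u)) *
          conj (form σ (fstPart (φ z)) (fstPart (fderiv ℝ φ z v))) +
        form σ (fstPart (φ z)) (fstPart (fderiv ℝ φ z u)) *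
          conj (form σ (fstPart (fderiv ℝ φ z w)) (fstPart (fderiv ℝ φ z v)))).re =
      4 * (form σ (fstPart w) (fstPart u) * conj (form σ (fstPart z) (fstPart v)) +
        form σ (fstPart z) (fstPart u) * conj (form σ (fstPart w) (fstPart v))).re := by
  have hl : HasDerivAt (fun s : ℝ => z + s • w) w 0 := by
    simpa using ((hasDerivAt_id (0 : ℝ)).smul_const w).const_add z
  have h0 : z + (0 : ℝ) • w = z := by simp
  have hφz : HasFDerivAt φ (fderiv ℝ φ z) (z + (0 : ℝ) • w) := by
    rw [h0]; exact (hφ.differentiable z).hasFDerivAt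
  have hDz : HasFDerivAt (fderiv ℝ φ) (fderiv ℝ (fderiv ℝ φ) z) (z + (0 : ℝ) • w) := by
    rw [h0]; exact (hφ.differentiable_fderiv z).hasFDerivAt
  have hc := hφz.comp_hasDerivAt 0 hl
  have hD (e : Space n) : HasDerivAt (fun s : ℝ => fderiv ℝ φ (z + s • w) e)
      (fderiv ℝ (fderiv ℝ φ) z w e) 0 :=
    (ContinuousLinearMap.apply ℝ (Space n) e).hasFDerivAt.comp_hasDerivAt (0 : ℝ)
      (hDz.comp_hasDerivAt (0 : ℝ) hl)
  have h₁ := hasDerivAt_metric σ hc (hD u) (hD v)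
  have h₂ := hasDerivAt_metric σ hl (hasDerivAt_const 0 u) (hasDerivAt_const 0 v)
  have h₃ : (fun s : ℝ => metric σ ((φ ∘ fun s : ℝ => z + s • w) s)
      (fderiv ℝ φ (z + s • w) u) (fderiv ℝ φ (z + s • w) v)) =
      fun s : ℝ => metric σ (z + s • w) u v := funext fun s => hφ.2.2 _ _ _
  rw [h₃] at h₁
  have h₄ := h₁.unique h₂
  simp only [Function.comp, h0] at h₄
  rw [h₄]
  simp [metric_eq]

/-- The transformation rule of the Christoffel symbols under an isometry. -/
lemma IsIsometry.metric_sndDeriv {σ : Matrix (Fin n) (Fin n) ℂ} {φ : Equiv.Perm (Space n)}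
    (hφ : IsIsometry σ φ) (z u w : Space n) :
    metric σ (φ z) (fderiv ℝ (fderiv ℝ φ) z u u) (fderiv ℝ φ z w) +
      4 * (form σ (fstPart (fderiv ℝ φ z u)) (fstPart (fderiv ℝ φ z u)) *
          conj (form σ (fstPart (φ z)) (fstPart (fderiv ℝ φ z w)))).re =
      4 * (form σ (fstPart u) (fstPart u) * conj (form σ (fstPart z) (fstPart w))).re := by
  -- Koszul's trick: the first identity minus half of the second eliminates the term containing the
  -- mixed second derivative in the directions `u`, `w`.
  have h₁ := hφ.metric_deriv z u u w
  have h₂ := hφ.metric_deriv z w u u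
  have hs : fderiv ℝ (fderiv ℝ φ) z w u = fderiv ℝ (fderiv ℝ φ) z u w :=
    (contDiff_infty.mp hφ.1 2).contDiffAt.isSymmSndFDerivAt (by simp) w u
  rw [hs, metric_comm σ _ (fderiv ℝ (fderiv ℝ φ) z u w), form_comm σ (fstPart w),
    form_comm σ (fstPart (fderiv ℝ φ z w))] at h₂
  simp only [add_re, mul_re, conj_re, conj_im] at h₁ h₂ ⊢
  linarith

/-! ### Geodesics and the rigidity of isometries. -/

/-- A curve with its velocity and acceleration, which solves the geodesic equation. -/
structure IsGeodesic (σ : Matrix (Fin n) (Fin n) ℂ) (c v a : ℝ → Space n) : Prop where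
  hasDerivAt : ∀ t, HasDerivAt c (v t) t
  hasDerivAt_velocity : ∀ t, HasDerivAt v (a t) t
  fst_accel : ∀ t, fstPart (a t) = 0
  snd_accel : ∀ t, sndPart (a t) = -(4 * form σ (fstPart (v t)) (fstPart (v t))) •
    star (covector σ (fstPart (c t)))

lemma eq_of_hasDerivAt_of_eq {E : Type*} [NormedAddCommGroup E] [NormedSpace ℝ E]
    {f g f' : ℝ → E} (hf : ∀ t, HasDerivAt f (f' t) t) (hg : ∀ t, HasDerivAt g (f' t) t)
    (h0 : f 0 = g 0) : f = g := by
  funext t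
  have h : ∀ t, HasDerivAt (fun s => f s - g s) 0 t := fun t => by
    simpa using (hf t).fun_sub (hg t)
  have := is_const_of_deriv_eq_zero (fun t => (h t).differentiableAt) (fun t => (h t).deriv) t 0
  simpa [h0, sub_eq_zero] using this

/-- The equation is triangular, so uniqueness needs only repeated integration: the first half is
affine in time, and it determines the acceleration of the second half. -/
lemma IsGeodesic.eq_of_initial {σ : Matrix (Fin n) (Fin n) ℂ} {c v a c₁ v₁ a₁ : ℝ → Space n}
    (h : IsGeodesic σ c v a) (h₁ : IsGeodesic σ c₁ v₁ a₁) (hc : c 0 = c₁ 0) (hv : v 0 = v₁ 0) :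
    c = c₁ := by
  have hX {f : ℝ → Space n} {f' : Space n} {t : ℝ} (hf : HasDerivAt f f' t) :
      HasDerivAt (fun s => fstPart (f s)) (fstPart f') t :=
    (fstPart (n := n)).hasFDerivAt.comp_hasDerivAt t hf
  have e₁ : (fun t => fstPart (v t)) = fun t => fstPart (v₁ t) :=
    eq_of_hasDerivAt_of_eq (f' := fun _ => 0)
      (fun t => by rw [← h.fst_accel t]; exact hX (h.hasDerivAt_velocity t))
      (fun t => by rw [← h₁.fst_accel t]; exact hX (h₁.hasDerivAt_velocity t)) (by rw [hv])
  have e₂ : (fun t => fstPart (c t)) = fun t => fstPart (c₁ t) :=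
    eq_of_hasDerivAt_of_eq (f' := fun t => fstPart (v t)) (fun t => hX (h.hasDerivAt t))
      (fun t => by rw [congrFun e₁ t]; exact hX (h₁.hasDerivAt t)) (by rw [hc])
  have e₃ : a = a₁ := funext fun t => by
    apply ext_parts
    · rw [h.fst_accel, h₁.fst_accel]
    · rw [h.snd_accel, h₁.snd_accel]
      simp only [congrFun e₁ t, congrFun e₂ t]
  have e₄ : v = v₁ := eq_of_hasDerivAt_of_eq h.hasDerivAt_velocity
    (e₃ ▸ h₁.hasDerivAt_velocity) hv
  exact eq_of_hasDerivAt_of_eq h.hasDerivAt (e₄ ▸ h₁.hasDerivAt) hc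

lemma eq_zero_of_re_pairing {x : Half n} (h : ∀ w : Half n, (pairing x w).re = 0) : x = 0 := by
  have h₂ : pairing x (I • x) = -I * pairing x x := by
    simp [pairing_apply]
  have h₃ := h (I • x)
  rw [h₂] at h₃
  have h₄ : x ⬝ᵥ star x = 0 := Complex.ext (h x) (by simpa [pairing_apply] using h₃)
  open scoped ComplexOrder in
  exact dotProduct_self_star_eq_zero.mp h₄

lemma conj_form (σ : Matrix (Fin n) (Fin n) ℂ) (x w : Half n) :
    conj (form σ x w) = pairing (star (covector σ x)) w := by
  rw [form_apply, pairing_apply, Matrix.star_dotProduct_star, dotProduct_comm]; rfl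

lemma pairing_smul_left (c : ℂ) (x w : Half n) : pairing (c • x) w = c * pairing x w := by
  simp [pairing_apply]

/-- Isometries map geodesics to geodesics. -/
lemma IsGeodesic.comp_isometry {σ : Matrix (Fin n) (Fin n) ℂ} {φ : Equiv.Perm (Space n)}
    (hφ : IsIsometry σ φ) {c v a : ℝ → Space n} (h : IsGeodesic σ c v a) :
    IsGeodesic σ (fun t => φ (c t)) (fun t => fderiv ℝ φ (c t) (v t))
      (fun t => fderiv ℝ (fderiv ℝ φ) (c t) (v t) (v t) + fderiv ℝ φ (c t) (a t)) := by
  -- The geodesic equation in weak form. It suffices to test it on vectors in the image of the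
  -- differential, which is everything; vertical and horizontal test vectors then give the two
  -- component equations.
  have key (t : ℝ) (w : Space n) : metric σ (φ (c t))
      (fderiv ℝ (fderiv ℝ φ) (c t) (v t) (v t) + fderiv ℝ φ (c t) (a t)) w +
      4 * (form σ (fstPart (fderiv ℝ φ (c t) (v t))) (fstPart (fderiv ℝ φ (c t) (v t))) *
          conj (form σ (fstPart (φ (c t))) (fstPart w))).re = 0 := by
    obtain ⟨w, rfl⟩ := hφ.fderiv_surjective (c t) w
    have h₁ := hφ.metric_sndDeriv (c t) (v t) w
    have h₂ := hφ.2.2 (c t) (a t) w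
    have h₃ : metric σ (c t) (a t) w =
        -(4 * (form σ (fstPart (v t)) (fstPart (v t)) *
          conj (form σ (fstPart (c t)) (fstPart w))).re) := by
      rw [metric_eq, h.fst_accel, h.snd_accel]
      simp only [map_zero, zero_apply, mul_zero, zero_mul, add_zero, zero_add,
        conj_form, pairing_smul_left]
      simp
      ring
    have h₄ : ∀ p q, metric σ (φ (c t)) (p + q) (fderiv ℝ φ (c t) w) =
        metric σ (φ (c t)) p (fderiv ℝ φ (c t) w) + metric σ (φ (c t)) q (fderiv ℝ φ (c t) w) :=
      fun p q => by simp [metric_eq]; ring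
    rw [h₄]
    linarith
  have hfst (t : ℝ) : fstPart
      (fderiv ℝ (fderiv ℝ φ) (c t) (v t) (v t) + fderiv ℝ φ (c t) (a t)) = 0 :=
    eq_zero_of_re_pairing fun w => by
      have := key t (join 0 w)
      simpa only [metric_eq, fstPart_join, sndPart_join, map_zero, mul_zero, add_zero, zero_re] using this
  refine ⟨fun t => ?_, fun t => ?_, hfst, fun t => ?_⟩
  · exact (hφ.differentiable (c t)).hasFDerivAt.comp_hasDerivAt t (h.hasDerivAt t)
  · exact ((hφ.differentiable_fderiv (c t)).hasFDerivAt.comp_hasDerivAt t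
      (h.hasDerivAt t)).clm_apply (h.hasDerivAt_velocity t)
  · rw [← sub_eq_zero]
    refine eq_zero_of_re_pairing fun w => ?_
    have := key t (join w 0)
    rw [metric_eq, hfst] at this
    simp only [fstPart_join, sndPart_join, map_zero, mul_zero, add_zero, zero_mul,
      zero_add] at this
    rw [map_sub, sub_apply, sub_re]
    rw [pairing_smul_left, ← conj_form]
    have h4 : ∀ c : ℂ, (4 * c).re = 4 * c.re := fun c => by simp
    rw [neg_mul, neg_re, mul_assoc, h4]
    linarith

/-- Any two points are joined by a geodesic. -/
lemma exists_isGeodesic (σ : Matrix (Fin n) (Fin n) ℂ) (p z : Space n) :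
    ∃ c v a, IsGeodesic σ c v a ∧ c 0 = p ∧ c 1 = z := by
  let ξ := fstPart (z - p)
  let P : Space n := join 0 ((4 * form σ ξ ξ) • star (covector σ (fstPart p)))
  let R : Space n := join 0 ((4 * form σ ξ ξ) • star (covector σ ξ))
  -- Along `fstPart p + t ξ` the acceleration is `-P - t R`. Two integrations give the cubic below,
  -- and `w` is the initial velocity for which it reaches `z` at time 1.
  let w : Space n := z - p + (1 / 2 : ℝ) • P + (1 / 6 : ℝ) • R
  have hw : fstPart w = ξ := by simp [w, P, R, ξ]
  have hpow (k : ℕ) (t : ℝ) (u : Space n) : HasDerivAt (fun s : ℝ => s ^ k • u)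
      ((k * t ^ (k - 1)) • u) t := by
    simpa using (hasDerivAt_pow k t).smul_const u
  refine ⟨fun t => p + t • w - (1 / 2 : ℝ) • t ^ 2 • P - (1 / 6 : ℝ) • t ^ 3 • R,
    fun t => w - t • P - (1 / 2 : ℝ) • t ^ 2 • R, fun t => - P - t • R,
    ⟨fun t => ?_, fun t => ?_, fun t => ?_, fun t => ?_⟩, ?_, ?_⟩
  · have h₁ := (((((hasDerivAt_id t).smul_const w).const_add p).fun_sub
      ((hpow 2 t P).const_smul (1 / 2 : ℝ))).fun_sub ((hpow 3 t R).const_smul (1 / 6 : ℝ)))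
    refine h₁.congr_deriv ?_
    simp only [smul_smul]
    norm_num
    ring_nf
  · have h₁ := ((((hasDerivAt_id t).smul_const P).const_sub w).fun_sub
      ((hpow 2 t R).const_smul (1 / 2 : ℝ)))
    refine h₁.congr_deriv ?_
    simp only [smul_smul]
    norm_num
    ring_nf
  · simp [P, R]
  · have h₁ : fstPart (w - t • P - (1 / 2 : ℝ) • t ^ 2 • R) = ξ := by simp [hw, P, R]
    have h₂ : fstPart (p + t • w - (1 / 2 : ℝ) • t ^ 2 • P - (1 / 6 : ℝ) • t ^ 3 • R) =
      fstPart p + (t : ℂ) • ξ := by simp [hw, P, R]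
    rw [h₁, h₂]
    ext a
    simp [P, R]
    ring
  · simp
  · simp [w]
    abel

/-- An isometry is determined by its value and its differential at a point. -/
lemma IsIsometry.eq_of_fderiv_eq {σ : Matrix (Fin n) (Fin n) ℂ} {φ ψ : Equiv.Perm (Space n)}
    (hφ : IsIsometry σ φ) (hψ : IsIsometry σ ψ) {p : Space n} (h : φ p = ψ p)
    (hd : fderiv ℝ φ p = fderiv ℝ ψ p) : φ = ψ := by
  ext1 z
  obtain ⟨c, v, a, hc, h0, h1⟩ := exists_isGeodesic σ p z
  have := (hc.comp_isometry hφ).eq_of_initial (hc.comp_isometry hψ) (by simp [h0, h])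
    (by simp [h0, hd])
  simpa [h1] using congrFun this 1

/-! ### Transvections and their group law. -/

lemma covector_surjective {σ : Matrix (Fin n) (Fin n) ℂ} (hdet : σ.det ≠ 0) :
    Function.Surjective (covector σ) := by
  have h : IsUnit σ.det := isUnit_iff_ne_zero.mpr hdet
  have h' : IsUnit σ.transpose.det := by rwa [Matrix.det_transpose]
  have hmul : polarMatrix σ * ((2 : ℂ) • Matrix.fromBlocks 0 σ.transpose⁻¹ σ⁻¹ 0) = 1 := by
    rw [polarMatrix, Matrix.smul_mul, Matrix.mul_smul, smul_smul, Matrix.fromBlocks_multiply]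
    simp [Matrix.mul_nonsing_inv _ h, Matrix.mul_nonsing_inv _ h']
  intro y
  exact ⟨Matrix.mulVec ((2 : ℂ) • Matrix.fromBlocks 0 σ.transpose⁻¹ σ⁻¹ 0) y, by
    rw [covector_apply, Matrix.mulVec_mulVec, hmul, Matrix.one_mulVec]⟩

/-- The underlying map of a transvection, with translation part `h`. -/
def transvFun (σ : Matrix (Fin n) (Fin n) ℂ) (h : Half n)
    (M : Matrix (HalfIdx n) (HalfIdx n) ℂ) (k : Half n) (z : Space n) : Space n :=
  z + join h (-(form σ (fstPart z) (fstPart z) + form σ (fstPart z + h) (fstPart z + h)) •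
    star (covector σ h) + Matrix.mulVec M (fstPart z) + k)

/-- The sum `form σ x x + form σ (x + h) (x + h)` is unchanged when `x`, `h` are replaced by `x +
h`, `-h`, while the covector of `h` changes sign. Hence the quadratic terms cancel, leaving only `M
h - k` to compensate. -/
lemma transvFun_neg (σ : Matrix (Fin n) (Fin n) ℂ) (h : Half n)
    (M : Matrix (HalfIdx n) (HalfIdx n) ℂ) (k : Half n) (z : Space n) :
    transvFun σ (-h) (-M) (Matrix.mulVec M h - k) (transvFun σ h M k z) = z := by
  apply ext_parts
  · simp [transvFun]
  · simp only [transvFun, map_add, fstPart_join, sndPart_join, map_neg, star_neg,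
      Matrix.mulVec_add, Matrix.neg_mulVec, add_neg_cancel_right]
    module

/-- The transvection with translation part `h`, linear part `M` and vertical translation `k`. -/
def transv (σ : Matrix (Fin n) (Fin n) ℂ) (h : Half n)
    (M : Matrix (HalfIdx n) (HalfIdx n) ℂ) (k : Half n) : Equiv.Perm (Space n) where
  toFun := transvFun σ h M k
  invFun := transvFun σ (-h) (-M) (Matrix.mulVec M h - k)
  left_inv := transvFun_neg σ h M k
  right_inv z := by
    have := transvFun_neg σ (-h) (-M) (Matrix.mulVec M h - k) z
    simpa [Matrix.mulVec_neg, Matrix.neg_mulVec] using this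

lemma transv_apply (σ : Matrix (Fin n) (Fin n) ℂ) (h : Half n)
    (M : Matrix (HalfIdx n) (HalfIdx n) ℂ) (k : Half n) (z : Space n) :
    transv σ h M k z = z + join h (-(form σ (fstPart z) (fstPart z) +
      form σ (fstPart z + h) (fstPart z + h)) • star (covector σ h) +
        Matrix.mulVec M (fstPart z) + k) := rfl

lemma transv_inv (σ : Matrix (Fin n) (Fin n) ℂ) (h : Half n)
    (M : Matrix (HalfIdx n) (HalfIdx n) ℂ) (k : Half n) :
    (transv σ h M k)⁻¹ = transv σ (-h) (-M) (Matrix.mulVec M h - k) := by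
  ext1 z
  rfl

/-- The cocycle of the transvection group: the skew-Hermitian matrix `η' η^* - η η'^*`, where
`η` and `η'` are the vectors dual to `h` and `h'`. -/
def cocycle (σ : Matrix (Fin n) (Fin n) ℂ) (h h' : Half n) :
    Matrix (HalfIdx n) (HalfIdx n) ℂ :=
  Matrix.vecMulVec (star (covector σ h')) (covector σ h) -
    Matrix.vecMulVec (star (covector σ h)) (covector σ h')

lemma cocycle_conjTranspose (σ : Matrix (Fin n) (Fin n) ℂ) (h h' : Half n) :
    (cocycle σ h h').conjTranspose = -cocycle σ h h' := by
  simp [cocycle, Matrix.conjTranspose_vecMulVec]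

lemma cocycle_swap (σ : Matrix (Fin n) (Fin n) ℂ) (h h' : Half n) :
    cocycle σ h' h = -cocycle σ h h' := by simp [cocycle]

lemma cocycle_mulVec (σ : Matrix (Fin n) (Fin n) ℂ) (h h' x : Half n) :
    Matrix.mulVec (cocycle σ h h') x =
      form σ h x • star (covector σ h') - form σ h' x • star (covector σ h) := by
  rw [cocycle, Matrix.sub_mulVec, Matrix.vecMulVec_mulVec, Matrix.vecMulVec_mulVec]
  simp [form_apply]

/-- Put `q(x) = form σ x x`. Compared with the quadratic term of `h + h'`, the coefficients of the
covectors of `h` and `h'` are off by `q(x) - q(x + h')` and `q(x + h + h') - q(x + h')`. Both are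
affine in `x`: their linear parts form twice the cocycle, their constants enter the vertical
translation. -/
lemma transv_mul (σ : Matrix (Fin n) (Fin n) ℂ) (h h' : Half n)
    (M M' : Matrix (HalfIdx n) (HalfIdx n) ℂ) (k k' : Half n) :
    transv σ h M k * transv σ h' M' k' = transv σ (h + h') (M + M' + (2 : ℂ) • cocycle σ h h')
      (k + k' + Matrix.mulVec M h' + (2 * form σ h' h + form σ h h) • star (covector σ h') -
        form σ h' h' • star (covector σ h)) := by
  ext1 z
  rw [Equiv.Perm.mul_apply]
  apply ext_parts
  · simp [transv_apply]
    abel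
  · simp only [transv_apply, map_add, fstPart_join, sndPart_join, star_add, Matrix.add_mulVec,
      Matrix.mulVec_add, Matrix.smul_mulVec, cocycle_mulVec, add_apply,
      form_comm σ (fstPart z) h, form_comm σ (fstPart z) h', form_comm σ h h']
    module

/-! ### Geodesic symmetries. -/

/-- The geodesic symmetry at `p`. -/
def geodesicSymm (σ : Matrix (Fin n) (Fin n) ℂ) (p : Space n) : Equiv.Perm (Space n) :=
  Function.Involutive.toPerm (fun z => p + p - z - join 0 ((4 * form σ (fstPart (z - p))
    (fstPart (z - p))) • star (covector σ (fstPart p)))) fun z => by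
    apply ext_parts
    · simp
    · simp
      module

lemma geodesicSymm_apply (σ : Matrix (Fin n) (Fin n) ℂ) (p z : Space n) :
    geodesicSymm σ p z = p + p - z - join 0 ((4 * form σ (fstPart (z - p))
      (fstPart (z - p))) • star (covector σ (fstPart p))) := rfl

lemma geodesicSymm_mul (σ : Matrix (Fin n) (Fin n) ℂ) (p q : Space n) :
    geodesicSymm σ p * geodesicSymm σ q = transv σ ((2 : ℂ) • (fstPart p - fstPart q))
      ((8 : ℂ) • cocycle σ (fstPart q) (fstPart p))
      ((2 : ℂ) • (sndPart p - sndPart q) +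
        (4 * form σ (fstPart q) (fstPart q)) • star (covector σ (fstPart q)) -
        (4 * form σ (fstPart p - (2 : ℂ) • fstPart q) (fstPart p - (2 : ℂ) • fstPart q)) •
          star (covector σ (fstPart p)) +
        (8 * form σ (fstPart p - fstPart q) (fstPart p - fstPart q)) •
          star (covector σ (fstPart p - fstPart q))) := by
  ext1 z
  rw [Equiv.Perm.mul_apply]
  apply ext_parts
  · simp [transv_apply, geodesicSymm_apply]
    module
  · simp only [transv_apply, geodesicSymm_apply, map_add, map_sub, map_smul, fstPart_join,
      sndPart_join, star_sub, star_smul, Matrix.smul_mulVec, cocycle_mulVec, add_apply,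
      sub_apply, form_smul_left, form_smul_right,
      form_comm σ (fstPart z) (fstPart p), form_comm σ (fstPart z) (fstPart q),
      form_comm σ (fstPart q) (fstPart p), RCLike.star_def, map_ofNat, sub_zero]
    module

lemma hasFDerivAt_geodesicSymm (σ : Matrix (Fin n) (Fin n) ℂ) (p z : Space n) :
    ∃ D : Space n →L[ℝ] Space n, HasFDerivAt (geodesicSymm σ p) D z ∧
      ∀ u, D u = -u - join 0 ((8 * form σ (fstPart (z - p)) (fstPart u)) •
        star (covector σ (fstPart p))) := by
  have h₁ := (hasFDerivAt_form_self σ (z - p)).comp z ((hasFDerivAt_id z).sub_const p)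
  have h₂ := (h₁.const_mul 4).smul_const (star (covector σ (fstPart p)))
  have h₃ := (joinCLM (n := n)).hasFDerivAt.comp z ((hasFDerivAt_const (0 : Half n) z).prodMk h₂)
  refine ⟨_, ((hasFDerivAt_id z).const_sub (p + p)).sub h₃, fun u => ?_⟩
  simp
  congr 2
  ring

lemma contDiff_geodesicSymm (σ : Matrix (Fin n) (Fin n) ℂ) (p : Space n) :
    ContDiff ℝ ∞ (geodesicSymm σ p) := by
  have h₁ : ContDiff ℝ ∞ fun z : Space n => form σ (fstPart (z - p)) (fstPart (z - p)) := by
    fun_prop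
  have h₂ : ContDiff ℝ ∞ fun z : Space n => joinCLM (0, (4 * form σ (fstPart (z - p))
      (fstPart (z - p))) • star (covector σ (fstPart p))) :=
    joinCLM.contDiff.comp (contDiff_const.prodMk ((contDiff_const.mul h₁).smul contDiff_const))
  exact (contDiff_const.sub contDiff_id).sub h₂

lemma pairing_smul_star_covector (σ : Matrix (Fin n) (Fin n) ℂ) (c : ℂ) (a u : Half n) :
    pairing u (c • star (covector σ a)) = conj c * form σ a u := by
  simp [pairing_apply, form_apply, dotProduct_comm]

lemma isSymmetryAt_geodesicSymm (σ : Matrix (Fin n) (Fin n) ℂ) (p : Space n) :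
    IsSymmetryAt σ p (geodesicSymm σ p) := by
  refine ⟨⟨contDiff_geodesicSymm σ p, contDiff_geodesicSymm σ p, fun z u v => ?_⟩, ?_, ?_⟩
  · obtain ⟨D, hD, hDu⟩ := hasFDerivAt_geodesicSymm σ p z
    rw [hD.fderiv, hDu, hDu, metric_eq, metric_eq, geodesicSymm_apply]
    congr 1
    -- With `x = p + d` in the first half, the quadratic part of the metric is evaluated at `p - d`
    -- instead of `p + d`. This changes it by `-8` times the mixed terms in `p`, `d`, which the
    -- vertical part of the differential restores.
    simp only [map_add, map_sub, map_neg, fstPart_join, sndPart_join, add_apply, sub_apply,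
      neg_apply, sub_zero, pairing_smul_star_covector, pairing_smul_left, ← conj_form, map_mul,
      map_ofNat]
    ring
  · simp [geodesicSymm_apply]
    exact ext_parts (by simp) (by simp)
  · obtain ⟨D, hD, hDu⟩ := hasFDerivAt_geodesicSymm σ p p
    rw [hD.fderiv]
    ext1 u
    rw [hDu]
    exact ext_parts (by simp) (by simp)

lemma IsSymmetryAt.eq_geodesicSymm {σ : Matrix (Fin n) (Fin n) ℂ} {p : Space n}
    {s : Equiv.Perm (Space n)} (hs : IsSymmetryAt σ p s) : s = geodesicSymm σ p := by
  have h := isSymmetryAt_geodesicSymm σ p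
  exact hs.1.eq_of_fderiv_eq h.1 (hs.2.1.trans h.2.1.symm) (hs.2.2.trans h.2.2.symm)

/-! ### The group generated by products of two symmetries. -/

/-- The group of all maps `transv σ h M k` with `M` skew-Hermitian. -/
def transvSubgroup (σ : Matrix (Fin n) (Fin n) ℂ) : Subgroup (Equiv.Perm (Space n)) where
  carrier := {φ | ∃ h M k, M.conjTranspose = -M ∧ φ = transv σ h M k}
  one_mem' := ⟨0, 0, 0, by simp, by
    ext1 z
    rw [transv_apply]
    exact ext_parts (by simp) (by simp)⟩
  mul_mem' := by
    rintro _ _ ⟨h, M, k, hM, rfl⟩ ⟨h', M', k', hM', rfl⟩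
    exact ⟨_, _, _, by simp [hM, hM', cocycle_conjTranspose]; abel, transv_mul σ h h' M M' k k'⟩
  inv_mem' := by
    rintro _ ⟨h, M, k, hM, rfl⟩
    exact ⟨_, _, _, by simp [hM], transv_inv σ h M k⟩

lemma geodesicSymm_mul_mem (σ : Matrix (Fin n) (Fin n) ℂ) (p q : Space n) :
    geodesicSymm σ p * geodesicSymm σ q ∈ transvectionGroup σ :=
  Subgroup.subset_closure ⟨p, q, _, _, isSymmetryAt_geodesicSymm σ p,
    isSymmetryAt_geodesicSymm σ q, rfl⟩

lemma transv_zero_mul (σ : Matrix (Fin n) (Fin n) ℂ) (h : Half n)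
    (M M' : Matrix (HalfIdx n) (HalfIdx n) ℂ) (k k' : Half n) :
    transv σ 0 M k * transv σ h M' k' = transv σ h (M + M') (k + k' + Matrix.mulVec M h) := by
  rw [transv_mul]
  simp [cocycle]

lemma transv_zero_zero_mem (σ : Matrix (Fin n) (Fin n) ℂ) (k : Half n) :
    transv σ 0 0 k ∈ transvectionGroup σ := by
  have h := geodesicSymm_mul_mem σ (join 0 ((1 / 2 : ℂ) • k)) 0
  rw [geodesicSymm_mul] at h
  simpa [cocycle] using h

/-- Taking one of the two symmetries at the origin makes the cocycle vanish; the resulting vertical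
part is then corrected by a vertical translation. -/
lemma transv_of_matrix_zero_mem (σ : Matrix (Fin n) (Fin n) ℂ) (h k : Half n) :
    transv σ h 0 k ∈ transvectionGroup σ := by
  have h₁ := geodesicSymm_mul_mem σ (join ((1 / 2 : ℂ) • h) 0) 0
  have h₂ : ∃ k', geodesicSymm σ (join ((1 / 2 : ℂ) • h) 0) * geodesicSymm σ 0 =
      transv σ h 0 k' := ⟨_, by rw [geodesicSymm_mul]; simp [cocycle]; rfl⟩
  obtain ⟨k', hk'⟩ := h₂
  have h₃ := mul_mem (transv_zero_zero_mem σ (k - k')) (hk' ▸ h₁)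
  rw [transv_zero_mul] at h₃
  simpa using h₃

/-- A product of two elements with zero matrix part has matrix part `2 • cocycle σ h h'`, and an
element with zero matrix part and the same translation part can be divided out. -/
lemma transv_cocycle_mem (σ : Matrix (Fin n) (Fin n) ℂ) (h h' : Half n) :
    transv σ 0 ((2 : ℂ) • cocycle σ h h') 0 ∈ transvectionGroup σ := by
  have h₁ := mul_mem (transv_of_matrix_zero_mem σ h 0) (transv_of_matrix_zero_mem σ h' 0)
  rw [transv_mul] at h₁
  have h₂ := transv_of_matrix_zero_mem σ (h + h')
  obtain ⟨k, hk⟩ : ∃ k, transv σ (h + h') ((2 : ℂ) • cocycle σ h h') k ∈ transvectionGroup σ :=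
    ⟨_, by simpa using h₁⟩
  have h₃ : transv σ 0 ((2 : ℂ) • cocycle σ h h') 0 * transv σ (h + h') 0
      (k - Matrix.mulVec ((2 : ℂ) • cocycle σ h h') (h + h')) =
      transv σ (h + h') ((2 : ℂ) • cocycle σ h h') k := by
    rw [transv_zero_mul]; simp
  rw [← h₃] at hk
  exact (Subgroup.mul_mem_cancel_right _ (h₂ _)).mp hk

lemma sum_vecMulVec_col {ι : Type*} [Fintype ι] [DecidableEq ι] (M : Matrix ι ι ℂ) :
    ∑ j, Matrix.vecMulVec (fun i => M i j) (Pi.single j 1) = M := by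
  ext a b
  simp [Matrix.sum_apply, Matrix.vecMulVec_apply, Pi.single_apply]

lemma exists_eq_sum_cocycle {σ : Matrix (Fin n) (Fin n) ℂ} (hdet : σ.det ≠ 0)
    {M : Matrix (HalfIdx n) (HalfIdx n) ℂ} (hM : M.conjTranspose = -M) :
    ∃ h h' : HalfIdx n → Half n, M = ∑ j, (2 : ℂ) • cocycle σ (h j) (h' j) := by
  choose h hh using fun j => covector_surjective hdet (Pi.single j 1)
  -- With `C` the matrix having only the `j`-th column of `M`, twice the cocycle is `(C - C^*) / 2`;
  -- this is where `1 / 4` comes from. Summing over `j` gives `(M - M^*) / 2 = M`.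
  choose h' hh' using fun j => covector_surjective hdet (star ((1 / 4 : ℂ) • fun i => M i j))
  refine ⟨h, h', ?_⟩
  have h₁ := sum_vecMulVec_col M
  have h₂ := congrArg Matrix.conjTranspose h₁
  rw [Matrix.conjTranspose_sum, hM] at h₂
  have h₃ : ∀ j, (2 : ℂ) • cocycle σ (h j) (h' j) = (1 / 2 : ℂ) •
      (Matrix.vecMulVec (fun i => M i j) (Pi.single j 1) -
        (Matrix.vecMulVec (fun i => M i j) (Pi.single j 1)).conjTranspose) := fun j => by
    rw [cocycle, hh, hh', star_star, Matrix.conjTranspose_vecMulVec]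
    ext a b
    simp [Matrix.vecMulVec_apply, Pi.single_apply]
    split_ifs <;> ring
  rw [Finset.sum_congr rfl fun j _ => h₃ j, ← Finset.smul_sum, Finset.sum_sub_distrib, h₁, h₂]
  module

lemma transv_matrix_mem {σ : Matrix (Fin n) (Fin n) ℂ} (hdet : σ.det ≠ 0)
    {M : Matrix (HalfIdx n) (HalfIdx n) ℂ} (hM : M.conjTranspose = -M) :
    transv σ 0 M 0 ∈ transvectionGroup σ := by
  obtain ⟨h, h', rfl⟩ := exists_eq_sum_cocycle hdet hM
  let S : AddSubmonoid (Matrix (HalfIdx n) (HalfIdx n) ℂ) :=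
    { carrier := {M | transv σ 0 M 0 ∈ transvectionGroup σ}
      zero_mem' := transv_zero_zero_mem σ 0
      add_mem' := fun {M M'} hM hM' => by
        have := (transvectionGroup σ).mul_mem hM hM'
        rw [transv_zero_mul] at this
        simpa using this }
  exact sum_mem (S := S) fun j _ => transv_cocycle_mem σ (h j) (h' j)

theorem transvectionGroup_eq {σ : Matrix (Fin n) (Fin n) ℂ} (hdet : σ.det ≠ 0) :
    transvectionGroup σ = transvSubgroup σ := by
  apply le_antisymm
  · refine (Subgroup.closure_le _).mpr ?_
    rintro _ ⟨p, q, s, t, hs, ht, rfl⟩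
    rw [hs.eq_geodesicSymm, ht.eq_geodesicSymm, geodesicSymm_mul]
    exact ⟨_, _, _, by simp [cocycle_conjTranspose], rfl⟩
  · rintro _ ⟨h, M, k, hM, rfl⟩
    have := mul_mem (transv_matrix_mem hdet hM)
      (transv_of_matrix_zero_mem σ h (k - Matrix.mulVec M h))
    rw [transv_zero_mul] at this
    simpa using this

/-! ### The lower central series. -/

section Nilpotency

open scoped commutatorElement

lemma transv_injective {σ : Matrix (Fin n) (Fin n) ℂ} {k k' : Half n}
    (h : transv σ 0 0 k = transv σ 0 0 k') : k = k' := by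
  have := congrArg sndPart (congrArg (fun φ : Equiv.Perm (Space n) => φ 0) h)
  simpa [transv_apply] using this

lemma transv_zero_zero_zero (σ : Matrix (Fin n) (Fin n) ℂ) : transv σ 0 0 0 = 1 := by
  ext1 z
  rw [transv_apply]
  exact ext_parts (by simp) (by simp)

lemma commutatorElement_eq_of_mul_eq {G : Type*} [Group G] {a b c : G}
    (h : c * (b * a) = a * b) : ⁅a, b⁆ = c := by
  rw [commutatorElement_def, ← h]
  group

/-- The cocycle is alternating, so the two orders of multiplication differ by `2 - (-2) = 4`
cocycles. The vertical part `l` is left unspecified because the next commutator does not depend on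
it. -/
lemma commutator_transv (σ : Matrix (Fin n) (Fin n) ℂ) (h h' : Half n)
    (M M' : Matrix (HalfIdx n) (HalfIdx n) ℂ) (k k' : Half n) :
    ∃ l, ⁅transv σ h M k, transv σ h' M' k'⁆ = transv σ 0 ((4 : ℂ) • cocycle σ h h') l := by
  have key : ∃ l, transv σ 0 ((4 : ℂ) • cocycle σ h h') l *
      (transv σ h' M' k' * transv σ h M k) = transv σ h M k * transv σ h' M' k' := by
    simp_rw [transv_mul σ h h', transv_mul σ h' h, transv_zero_mul, add_comm h' h,
      cocycle_swap σ h h']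
    have hm : (4 : ℂ) • cocycle σ h h' + (M' + M + (2 : ℂ) • -cocycle σ h h') =
      M + M' + (2 : ℂ) • cocycle σ h h' := by module
    rw [hm]
    have hl : ∀ a b c : Half n, ∃ l, l + a + b = c := fun a b c => ⟨c - b - a, by abel⟩
    exact (hl _ _ _).imp fun l hl => congrArg _ hl
  obtain ⟨l, hl⟩ := key
  exact ⟨l, commutatorElement_eq_of_mul_eq hl⟩

lemma commutator_transv_zero (σ : Matrix (Fin n) (Fin n) ℂ) (h' : Half n)
    (M M' : Matrix (HalfIdx n) (HalfIdx n) ℂ) (k k' : Half n) :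
    ⁅transv σ 0 M k, transv σ h' M' k'⁆ = transv σ 0 0 (Matrix.mulVec M h') := by
  apply commutatorElement_eq_of_mul_eq
  rw [transv_mul σ h' 0, transv_zero_mul, transv_zero_mul]
  have hM : M' + M = M + M' := add_comm _ _
  simp [cocycle, hM]
  congr 1
  abel

/-- The group of the maps `transv σ 0 M k`, which preserve the first half. -/
def transvSubgroupFst (σ : Matrix (Fin n) (Fin n) ℂ) : Subgroup (Equiv.Perm (Space n)) where
  carrier := {φ | ∃ M k, φ = transv σ 0 M k}
  one_mem' := ⟨0, 0, (transv_zero_zero_zero σ).symm⟩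
  mul_mem' := by
    rintro _ _ ⟨M, k, rfl⟩ ⟨M', k', rfl⟩
    exact ⟨_, _, transv_zero_mul σ 0 M M' k k'⟩
  inv_mem' := by
    rintro _ ⟨M, k, rfl⟩
    exact ⟨_, _, by rw [transv_inv, neg_zero]⟩

/-- The group of the vertical translations. -/
def transvSubgroupSnd (σ : Matrix (Fin n) (Fin n) ℂ) : Subgroup (Equiv.Perm (Space n)) where
  carrier := {φ | ∃ k, φ = transv σ 0 0 k}
  one_mem' := ⟨0, (transv_zero_zero_zero σ).symm⟩
  mul_mem' := by
    rintro _ _ ⟨k, rfl⟩ ⟨k', rfl⟩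
    exact ⟨_, by rw [transv_zero_mul, add_zero]⟩
  inv_mem' := by
    rintro _ ⟨k, rfl⟩
    exact ⟨_, by rw [transv_inv, neg_zero, neg_zero]⟩

lemma lowerCentralSeries_one_le (σ : Matrix (Fin n) (Fin n) ℂ) :
    (transvSubgroup σ).lowerCentralSeries 1 ≤ transvSubgroupFst σ := by
  refine Subgroup.commutator_le.mpr ?_
  rintro _ ⟨h, M, k, hM, rfl⟩ _ ⟨h', M', k', hM', rfl⟩
  obtain ⟨l, hl⟩ := commutator_transv σ h h' M M' k k'
  exact ⟨_, l, hl⟩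

lemma lowerCentralSeries_two_le (σ : Matrix (Fin n) (Fin n) ℂ) :
    (transvSubgroup σ).lowerCentralSeries 2 ≤ transvSubgroupSnd σ := by
  refine Subgroup.commutator_le.mpr fun φ hφ ψ hψ => ?_
  obtain ⟨M, k, rfl⟩ := lowerCentralSeries_one_le σ hφ
  obtain ⟨h', M', k', hM', rfl⟩ := hψ
  exact ⟨_, commutator_transv_zero σ h' M M' k k'⟩

lemma lowerCentralSeries_three (σ : Matrix (Fin n) (Fin n) ℂ) :
    (transvSubgroup σ).lowerCentralSeries 3 = ⊥ := by
  refine le_bot_iff.mp (Subgroup.commutator_le.mpr fun φ hφ ψ hψ => ?_)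
  obtain ⟨k, rfl⟩ := lowerCentralSeries_two_le σ hφ
  obtain ⟨h', M', k', hM', rfl⟩ := hψ
  rw [commutator_transv_zero, Matrix.zero_mulVec, transv_zero_zero_zero]
  exact Subgroup.one_mem _

lemma lowerCentralSeries_two_ne_bot (hn : 0 < n) {σ : Matrix (Fin n) (Fin n) ℂ}
    (hdet : σ.det ≠ 0) : (transvSubgroup σ).lowerCentralSeries 2 ≠ ⊥ := by
  intro hbot
  -- If `h` has the all-ones covector, the cocycle of `h` and `I • h` is `-2i` times the all-ones
  -- matrix. It does not kill the all-ones vector, so the triple commutator below is a non-trivial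
  -- vertical translation.
  obtain ⟨h, hh⟩ := covector_surjective hdet (fun _ => 1)
  have hmem : ∀ l : Half n, transv σ l 0 0 ∈ transvSubgroup σ :=
    fun l => ⟨l, 0, 0, by simp, rfl⟩
  have h₁ : ⁅⁅transv σ h 0 0, transv σ (I • h) 0 0⁆, transv σ (fun _ => 1) 0 0⁆ ∈
      (transvSubgroup σ).lowerCentralSeries 2 :=
    Subgroup.commutator_mem_commutator
      (Subgroup.commutator_mem_commutator (hmem h) (hmem _)) (hmem _)
  obtain ⟨l, hl⟩ := commutator_transv σ h (I • h) 0 0 0 0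
  rw [hl, commutator_transv_zero, hbot, Subgroup.mem_bot, ← transv_zero_zero_zero σ] at h₁
  have h₂ := congrFun (transv_injective h₁) (Sum.inl ⟨0, hn⟩)
  rw [Matrix.smul_mulVec, cocycle_mulVec] at h₂
  simp [form_apply, hh, dotProduct] at h₂
  have h₃ := congrArg Complex.im h₂
  have hn' : (0 : ℝ) < n := Nat.cast_pos.mpr hn
  simp at h₃
  linarith

lemma isNilpotent_transvSubgroup (σ : Matrix (Fin n) (Fin n) ℂ) :
    Group.IsNilpotent (transvSubgroup σ) :=
  (Subgroup.isNilpotent_iff_lowerCentralSeries _).mpr ⟨3, lowerCentralSeries_three σ⟩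

/-- Passes between the series of `H` as a group, which defines the nilpotency class, and the series
computed inside the ambient group. -/
lemma lowerCentralSeries_top_eq_bot_iff {G : Type*} [Group G] (H : Subgroup G) (m : ℕ) :
    (⊤ : Subgroup H).lowerCentralSeries m = ⊥ ↔ H.lowerCentralSeries m = ⊥ := by
  rw [← Subgroup.top_subtype_lowerCentralSeries H, Subgroup.map_eq_bot_iff_of_injective _
    H.subtype_injective]

lemma nilpotencyClass_transvSubgroup (hn : 0 < n) {σ : Matrix (Fin n) (Fin n) ℂ}
    (hdet : σ.det ≠ 0) : Group.nilpotencyClass (transvSubgroup σ) = 3 := by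
  have := isNilpotent_transvSubgroup σ
  refine le_antisymm ?_ (Nat.succ_le_of_lt (lt_of_not_ge fun h => ?_))
  · exact Subgroup.lowerCentralSeries_eq_bot_iff_nilpotencyClass_le.mp
      ((lowerCentralSeries_top_eq_bot_iff _ _).mpr (lowerCentralSeries_three σ))
  · exact lowerCentralSeries_two_ne_bot hn hdet ((lowerCentralSeries_top_eq_bot_iff _ _).mp
      (Subgroup.lowerCentralSeries_eq_bot_iff_nilpotencyClass_le.mpr h))

end Nilpotency

/-! ### The isotropy group and its Lie algebra. -/

/-- The endomorphism `(x, y) ↦ (0, M x)` of the tangent space. -/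
def vertMap : Matrix (HalfIdx n) (HalfIdx n) ℂ →ₗ[ℝ] Space n →L[ℝ] Space n where
  toFun M := joinCLM.comp ((ContinuousLinearMap.inr ℝ (Half n) (Half n)).comp
    (((LinearMap.toContinuousLinearMap (Matrix.mulVecLin M)).restrictScalars ℝ).comp fstPart))
  map_add' M M' := by
    ext1 u
    exact ext_parts (by simp) (by simp)
  map_smul' c M := by
    ext1 u
    exact ext_parts (by simp) (by simp)

lemma vertMap_apply (M : Matrix (HalfIdx n) (HalfIdx n) ℂ) (u : Space n) :
    vertMap M u = join 0 (Matrix.mulVec M (fstPart u)) := rfl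

lemma vertMap_injective : Function.Injective (vertMap (n := n)) := by
  intro M M' h
  refine Matrix.mulVec_injective (funext fun x => ?_)
  simpa [vertMap_apply] using
    congrArg sndPart (congrArg (fun A : Space n →L[ℝ] Space n => A (join x 0)) h)

lemma vertMap_mul (M M' : Matrix (HalfIdx n) (HalfIdx n) ℂ) : vertMap M * vertMap M' = 0 := by
  ext1 u
  exact ext_parts (by simp [vertMap_apply]) (by simp [vertMap_apply])

lemma isNilpotent_vertMap (M : Matrix (HalfIdx n) (HalfIdx n) ℂ) : IsNilpotent (vertMap M) :=
  ⟨2, by rw [sq, vertMap_mul]⟩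

lemma fderiv_transv_zero (σ : Matrix (Fin n) (Fin n) ℂ) (M : Matrix (HalfIdx n) (HalfIdx n) ℂ)
    (k : Half n) (p : Space n) :
    fderiv ℝ (transv σ 0 M k) p = ContinuousLinearMap.id ℝ (Space n) + vertMap M := by
  have h : (transv σ 0 M k : Space n → Space n) = fun z => z + vertMap M z + join 0 k := by
    funext z
    exact ext_parts (by simp [transv_apply, vertMap_apply])
      (by simp [transv_apply, vertMap_apply]; abel)
  rw [h]
  exact (((hasFDerivAt_id p).add (vertMap M).hasFDerivAt).add_const _).fderiv

/-- The first half of the equation `φ p = p` says `h = 0`; the quadratic term then disappears and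
the second half says `M x + k = 0` at `x = fstPart p`. -/
lemma mem_isotropyGroup_iff {σ : Matrix (Fin n) (Fin n) ℂ} (hdet : σ.det ≠ 0) {p : Space n}
    {φ : Equiv.Perm (Space n)} : φ ∈ isotropyGroup σ p ↔
      ∃ M : Matrix (HalfIdx n) (HalfIdx n) ℂ, M.conjTranspose = -M ∧
        φ = transv σ 0 M (-Matrix.mulVec M (fstPart p)) := by
  rw [isotropyGroup, transvectionGroup_eq hdet, Subgroup.mem_inf, MulAction.mem_stabilizer_iff,
    Equiv.Perm.smul_def]
  constructor
  · rintro ⟨⟨h, M, k, hM, rfl⟩, hp⟩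
    obtain rfl : h = 0 := by simpa [transv_apply] using congrArg fstPart hp
    have hk := congrArg sndPart hp
    simp [transv_apply] at hk
    exact ⟨M, hM, by rw [eq_neg_of_add_eq_zero_right hk]⟩
  · rintro ⟨M, hM, rfl⟩
    refine ⟨⟨0, M, _, hM, rfl⟩, ?_⟩
    exact ext_parts (by simp [transv_apply]) (by simp [transv_apply])

lemma exp_eq_one_add_of_mul_self {A : Type*} [NormedRing A] [NormedAlgebra ℝ A] [CompleteSpace A]
    {a : A} (h : a * a = 0) : NormedSpace.exp a = 1 + a := by
  rw [NormedSpace.exp_eq_tsum ℝ]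
  have h' : ∀ m ∉ Finset.range 2, ((m.factorial : ℝ)⁻¹) • a ^ m = 0 := fun m hm => by
    rw [Finset.mem_range, not_lt] at hm
    rw [pow_eq_zero_of_le hm (by rw [sq, h]), smul_zero]
  simp only [tsum_eq_sum h']
  simp [Finset.sum_range_succ]

/-- If the one-parameter group generated by `A` stays in a translate of a closed subspace, then
`A` lies in this subspace. -/
lemma mem_of_exp_smul_sub_one_mem {A : Type*} [NormedRing A] [NormedAlgebra ℝ A] [CompleteSpace A]
    {W : Submodule ℝ A} (hW : IsClosed (W : Set A)) {a : A}
    (h : ∀ t : ℝ, NormedSpace.exp (t • a) - 1 ∈ W) : a ∈ W := by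
  have hd := hasDerivAt_exp_smul_const (𝕂 := ℝ) a 0
  rw [zero_smul, NormedSpace.exp_zero, one_mul, hasDerivAt_iff_tendsto_slope_zero] at hd
  refine hW.mem_of_tendsto hd (Filter.Eventually.of_forall fun t => W.smul_mem _ ?_)
  simpa using h (0 + t)

/-- The Lie algebra of the endomorphisms `(x, y) ↦ (0, M x)` with `M` skew-Hermitian. -/
def vertLieSubalgebra (n : ℕ) : LieSubalgebra ℝ (Space n →L[ℝ] Space n) where
  __ := (skewAdjoint.submodule ℝ (Matrix (HalfIdx n) (HalfIdx n) ℂ)).map vertMap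
  lie_mem' := by
    rintro _ _ ⟨M, -, rfl⟩ ⟨M', -, rfl⟩
    rw [LieRing.of_associative_ring_bracket, vertMap_mul, vertMap_mul, sub_zero]
    exact Submodule.zero_mem _

/-- Since `vertMap M` squares to zero, its exponential is `1 + vertMap M`, a differential of an
isotropy element. Conversely all these differentials lie in `1 + W` with `W` a closed subspace,
which then contains every generator. -/
lemma isotropyAlgebra_eq {σ : Matrix (Fin n) (Fin n) ℂ} (hdet : σ.det ≠ 0) (p : Space n) :
    (vertLieSubalgebra n : Set (Space n →L[ℝ] Space n)) = isotropyAlgebra σ p := by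
  ext A
  constructor
  · rintro ⟨M, hM, rfl⟩ t
    have hM' : M.conjTranspose = -M := hM
    refine ⟨_, (mem_isotropyGroup_iff hdet).mpr ⟨t • M, by simp [hM'], rfl⟩, ?_⟩
    rw [fderiv_transv_zero, ← map_smul, exp_eq_one_add_of_mul_self (vertMap_mul _ _)]
    rfl
  · intro hA
    refine mem_of_exp_smul_sub_one_mem (W := (vertLieSubalgebra n).toSubmodule)
      (Submodule.closed_of_finiteDimensional _) fun t => ?_
    obtain ⟨φ, hφ, h⟩ := hA t
    obtain ⟨M, hM, rfl⟩ := (mem_isotropyGroup_iff hdet).mp hφ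
    rw [← h, fderiv_transv_zero]
    exact ⟨M, hM, (add_sub_cancel_left _ _).symm⟩

/-! ### The real dimension of the skew-Hermitian matrices. -/

/-- Multiplication by `-i` identifies skew-adjoint with self-adjoint elements. -/
lemma finrank_skewAdjoint_eq (A : Type*) [AddCommGroup A] [Module ℂ A] [StarAddMonoid A]
    [StarModule ℂ A] :
    Module.finrank ℝ (skewAdjoint A) = Module.finrank ℝ (selfAdjoint A) := by
  refine (LinearEquiv.ofBijective (skewAdjoint.negISMul (A := A)) ⟨fun a b h => ?_,
    fun b => ?_⟩).finrank_eq
  · apply Subtype.ext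
    rw [← skewAdjoint.I_smul_neg_I a, h, skewAdjoint.I_smul_neg_I]
  · refine ⟨⟨I • (b : A), ?_⟩, Subtype.ext ?_⟩
    · rw [skewAdjoint.mem_iff, star_smul, b.2.star_eq]; simp
    · simp [skewAdjoint.negISMul, smul_smul]

/-- Matrices split into self-adjoint and skew-adjoint parts of equal real dimension, and the total
is twice the square of the size. -/
lemma finrank_skewAdjoint_matrix (m : Type*) [Fintype m] [DecidableEq m] :
    Module.finrank ℝ (skewAdjoint (Matrix m m ℂ)) = Fintype.card m ^ 2 := by
  let _ : Invertible (2 : ℝ) := invertibleOfNonzero two_ne_zero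
  have h₁ := (StarModule.decomposeProdAdjoint ℝ (Matrix m m ℂ)).finrank_eq
  have : FiniteDimensional ℝ (skewAdjoint (Matrix m m ℂ)) :=
    inferInstanceAs (FiniteDimensional ℝ (skewAdjoint.submodule ℝ (Matrix m m ℂ)))
  have : FiniteDimensional ℝ (selfAdjoint (Matrix m m ℂ)) :=
    inferInstanceAs (FiniteDimensional ℝ (selfAdjoint.submodule ℝ (Matrix m m ℂ)))
  rw [Module.finrank_prod, Module.finrank_matrix, Complex.finrank_real_complex,
    ← finrank_skewAdjoint_eq] at h₁
  nlinarith

lemma finrank_vertLieSubalgebra (n : ℕ) :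
    Module.finrank ℝ (vertLieSubalgebra n) = 4 * n ^ 2 := by
  have h := (Submodule.equivMapOfInjective vertMap vertMap_injective
    (skewAdjoint.submodule ℝ (Matrix (HalfIdx n) (HalfIdx n) ℂ))).finrank_eq
  refine h.symm.trans ((finrank_skewAdjoint_matrix (HalfIdx n)).trans ?_)
  simp
  ring

end KahlerTransvection

end

open KahlerTransvection in
theorem proposition2p3 (n : ℕ) (hn : 0 < n) (σ : Matrix (Fin n) (Fin n) ℂ)
    (hσ : σ.IsSymm) (hdet : σ.det ≠ 0) :
    (Group.IsNilpotent (transvectionGroup σ) ∧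
      Group.nilpotencyClass (transvectionGroup σ) = 3) ∧
    ∀ p : Space n,
      (∀ φ ∈ isotropyGroup σ p, ∀ ψ ∈ isotropyGroup σ p, φ * ψ = ψ * φ) ∧
      (∀ φ ∈ isotropyGroup σ p,
        IsNilpotent (fderiv ℝ φ p - ContinuousLinearMap.id ℝ (Space n))) ∧
      ∃ 𝔥 : LieSubalgebra ℝ (Space n →L[ℝ] Space n),
        (𝔥 : Set (Space n →L[ℝ] Space n)) = isotropyAlgebra σ p ∧
        IsLieAbelian 𝔥 ∧
        (∀ A ∈ 𝔥, IsNilpotent A) ∧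
        Module.finrank ℝ 𝔥 = 4 * n ^ 2 := by
  refine ⟨?_, fun p => ⟨fun φ hφ ψ hψ => ?_, fun φ hφ => ?_, vertLieSubalgebra n,
    isotropyAlgebra_eq hdet p, ⟨fun A B => Subtype.ext ?_⟩, ?_, finrank_vertLieSubalgebra n⟩⟩
  · rw [transvectionGroup_eq hdet]
    exact ⟨isNilpotent_transvSubgroup σ, nilpotencyClass_transvSubgroup hn hdet⟩
  · obtain ⟨M, -, rfl⟩ := (mem_isotropyGroup_iff hdet).mp hφ
    obtain ⟨M', -, rfl⟩ := (mem_isotropyGroup_iff hdet).mp hψ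
    rw [transv_zero_mul, transv_zero_mul, add_comm M' M, Matrix.mulVec_zero, Matrix.mulVec_zero,
      add_comm (-Matrix.mulVec M' _)]
  · obtain ⟨M, -, rfl⟩ := (mem_isotropyGroup_iff hdet).mp hφ
    rw [fderiv_transv_zero, add_sub_cancel_left]
    exact isNilpotent_vertMap M
  · obtain ⟨_, M, -, rfl⟩ := A
    obtain ⟨_, M', -, rfl⟩ := B
    change ⁅vertMap M, vertMap M'⁆ = 0
    rw [LieRing.of_associative_ring_bracket, vertMap_mul, vertMap_mul, sub_zero]
  · rintro _ ⟨M, -, rfl⟩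
    exact isNilpotent_vertMap M
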